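/- Let $P(k)=22k^2-92k+11$ and let $H_n=\sum_{i=1}^n \frac1i$ be the $n$-th harmonic number. Then the following four series converge, with the stated sums: \begin{align*} \sum_{k=1}^\infty \frac{\binom{4k}{k}}{16^k}\left(P(k)H_{k}-54k+108-\frac{10}{3k}\right)&=-\frac{20}{3}\log 2,\\ \sum_{k=1}^\infty \frac{\binom{4k}{k}}{16^k}\left(P(k)H_{2k}+287k-115-\frac{25}{6k}\right)&=214-\frac{40}{3}\log 2,\\ \sum_{k=1}^\infty \frac{\binom{4k}{k}}{16^k}\left(P(k)H_{3k}-296k+178-\frac{25}{3k}\right)&=-196-\frac{80}{3}\log 2,\\ \sum_{k=1}^\infty \frac{\binom{4k}{k}}{16^k}\left(P(k)H_{4k}-\frac{449k-275}{2}-\frac{85}{12k}\right)&=-151-\frac{80}{3}\log 2. \end{align*} -/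

import Mathlib

/-- The quadratic polynomial `P(k) = 22 k ^ 2 - 92 k + 11`, as a real number. -/
def P (k : ℕ) : ℝ := 22 * (k : ℝ) ^ 2 - 92 * (k : ℝ) + 11

/-- The harmonic number `H n = 1 + 1 / 2 + ⋯ + 1 / n` (with `H 0 = 0`), as a real number. -/
noncomputable def H (n : ℕ) : ℝ := (harmonic n : ℝ)

/-! With `x = (y - 1) / y ^ 4` on the branch near `y = 1`, the generating function of `(4k choose
k)` is `y / (4 - 3y)` (`hasSum_choose_subst`). Applying `x d/dx` inserts factors `k`; integrating
gives the sum with `1 / k`, namely `4 log y`. At `x = 1/16` the branch takes the value `y = 2w` with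
`w ^ 3 + w ^ 2 + w = 1`, so all non-harmonic sums lie in `ℚ(w)`, up to multiples of `log (2w)`.

The harmonic numbers enter through `H n = ∫₀¹ (1 - t ^ n) / (1 - t) dt`: the sum of `a k * H (m *
k)` is the integral of `(A - B(t)) / (1 - t)`, where `A` and `B(t)` are the sums of `a k` and `a k *
t ^ (m * k)`. For `m = 1, 2, 3, 4` the curve `t ^ m = 16 (y - 1) / y ^ 4` has a rational
parametrization by some `u`, so the integrand is rational in `u`. The polynomial `P` makes `A = -5`
(`sumP_root`), which lets the cubic factor of `1 - t` cancel; what remains has an explicit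
primitive, checked by differentiation (`hasSum_P_mul_harmonic_of_primitive`).

The values found involve `w`, `log w`, `log (1 - w)` and `log (1 - w ^ 2)`. The relations `(1 - w) ^
3 = 2 w ^ 5` and `(1 - w ^ 2) ^ 3 = 4 w ^ 4` leave only `log 2` and `log w`. The corrections linear
in `k` cancel the irrational part in `ℚ(w)`, and the `1 / k` correction cancels `log w`. -/

/-! ### The generating function of `(4k choose k)`. -/

-- Both sides are the coefficient of `X ^ n` in `((1 + X) ^ 4 - 1) ^ n`: expand by the binomial
-- theorem on one side, and factor out `X ^ n` on the other, leaving a polynomial with constant term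
-- `4 ^ n`.
open Finset in
theorem sum_neg_one_pow_mul_choose_mul_choose (n : ℕ) :
    ∑ p ∈ antidiagonal n, (((4 * p.1).choose p.1 : ℤ) * ((3 * p.1).choose p.2) * (-1) ^ p.2)
      = 4 ^ n := by
  have hpoly : ((1 + Polynomial.X : Polynomial ℤ) ^ 4 - 1) ^ n =
      ∑ k ∈ range (n + 1), (1 + Polynomial.X : Polynomial ℤ) ^ (4 * k) *
        Polynomial.C ((-1) ^ (n - k) * (n.choose k : ℤ)) := by
    rw [sub_eq_add_neg, add_pow]
    refine sum_congr rfl fun k _ => ?_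
    simp [pow_mul, mul_assoc]
  have hfac : ((1 + Polynomial.X : Polynomial ℤ) ^ 4 - 1) ^ n =
      (4 + 6 * Polynomial.X + 4 * Polynomial.X ^ 2 + Polynomial.X ^ 3) ^ n
        * Polynomial.X ^ n := by
    rw [← mul_pow]
    congr 1
    ring
  have hcoeff := congrArg (fun p => Polynomial.coeff p n) (hpoly.symm.trans hfac)
  simp only [Polynomial.finsetSum_coeff, Polynomial.coeff_mul_C,
    Polynomial.coeff_one_add_X_pow, Polynomial.coeff_mul_X_pow', le_refl, if_true,
    Nat.sub_self, Polynomial.coeff_zero_eq_eval_zero] at hcoeff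
  rw [Nat.sum_antidiagonal_eq_sum_range_succ_mk]
  refine Eq.trans (sum_congr rfl fun k hk => ?_) (hcoeff.trans (by simp))
  have hk' : k ≤ n := Nat.lt_succ_iff.mp (mem_range.mp hk)
  have h : (4 * k).choose n * n.choose k = (4 * k).choose k * (3 * k).choose (n - k) := by
    rw [Nat.choose_mul hk', show 4 * k - k = 3 * k by omega]
  have h' : ((4 * k).choose n : ℤ) * n.choose k = (4 * k).choose k * (3 * k).choose (n - k) := by
    exact_mod_cast h
  simp only
  rw [← h']
  ring

/-- One term of the expansion of `(1/4 + 3/4) ^ (4k) = 1` is at most `1`, and `256/27` is the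
inverse of `(1/4) (3/4) ^ 3`. -/
theorem choose_four_mul_le (k : ℕ) : ((4 * k).choose k : ℝ) ≤ (256 / 27) ^ k := by
  have h := add_pow (1 / 4 : ℝ) (3 / 4) (4 * k)
  have h1 : (1 / 4 : ℝ) ^ k * (3 / 4) ^ (4 * k - k) * ((4 * k).choose k) ≤ 1 := by
    have h2 : (1 / 4 + 3 / 4 : ℝ) ^ (4 * k) = 1 := by norm_num
    refine le_trans ?_ (h.symm.trans h2).le
    have hk : k ∈ Finset.range (4 * k + 1) := Finset.mem_range.mpr (by omega)
    exact Finset.single_le_sum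
      (f := fun m => (1 / 4 : ℝ) ^ m * (3 / 4) ^ (4 * k - m) * ((4 * k).choose m))
      (fun i _ => by positivity) hk
  have h3 : (1 / 4 : ℝ) ^ k * (3 / 4) ^ (4 * k - k) = ((256 / 27 : ℝ) ^ k)⁻¹ := by
    rw [show 4 * k - k = 3 * k by omega, pow_mul, ← mul_pow, ← inv_pow]
    norm_num
  rw [h3] at h1
  have h4 : (0 : ℝ) < (256 / 27) ^ k := by positivity
  rw [inv_mul_le_iff₀ h4] at h1
  linarith

theorem hasSum_choose_mul_pow (n : ℕ) (r : ℝ) :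
    HasSum (fun j => (n.choose j : ℝ) * r ^ j) ((1 + r) ^ n) := by
  have h : (1 + r) ^ n = ∑ j ∈ Finset.range (n + 1), (n.choose j : ℝ) * r ^ j := by
    rw [add_comm, add_pow]
    exact Finset.sum_congr rfl fun j _ => by simp [mul_comm]
  rw [h]
  refine hasSum_sum_of_ne_finset_zero fun j hj => ?_
  rw [Nat.choose_eq_zero_of_lt (by simpa [Nat.lt_succ_iff] using hj)]
  simp

/-- Absolute convergence of the double series needs `|q| (1 + |q|) ^ 3 < 27/256`. The bound `41/500`
is just small enough for this, and large enough for `q = 1 - 1 / y` with `y` in `substDomain`. -/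
theorem summable_choose_mul_choose {q : ℝ} (hq : |q| ≤ 41 / 500) :
    Summable (fun p : ℕ × ℕ =>
      ((4 * p.1).choose p.1 : ℝ) * q ^ p.1 * (((3 * p.1).choose p.2 : ℝ) * (-q) ^ p.2)) := by
  rw [← summable_norm_iff, summable_prod_of_nonneg (fun _ => norm_nonneg _)]
  have hrow : ∀ k : ℕ, HasSum (fun j => ‖((4 * k).choose k : ℝ) * q ^ k *
      (((3 * k).choose j : ℝ) * (-q) ^ j)‖)
      (((4 * k).choose k : ℝ) * |q| ^ k * (1 + |q|) ^ (3 * k)) := by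
    intro k
    refine ((hasSum_choose_mul_pow (3 * k) |q|).mul_left
      (((4 * k).choose k : ℝ) * |q| ^ k)).congr_fun fun j => ?_
    simp only [Real.norm_eq_abs, abs_mul, abs_pow, abs_neg, Nat.abs_cast]
  refine ⟨fun k => (hrow k).summable, ?_⟩
  simp only [fun k => (hrow k).tsum_eq]
  refine Summable.of_nonneg_of_le (fun k => by positivity) (fun k => ?_)
    (summable_geometric_of_lt_one (r := 256 / 27 * (13 / 125)) (by norm_num) (by norm_num))
  rw [mul_pow, mul_assoc, pow_mul, ← mul_pow]
  refine mul_le_mul (choose_four_mul_le k) (pow_le_pow_left₀ (by positivity) ?_ k)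
    (by positivity) (by positivity)
  calc |q| * (1 + |q|) ^ 3 ≤ 41 / 500 * (1 + 41 / 500) ^ 3 := by gcongr
    _ ≤ 13 / 125 := by norm_num

open Finset.HasAntidiagonal in
theorem HasSum.sum_antidiagonal {f : ℕ × ℕ → ℝ} {a : ℝ} (h : HasSum f a) :
    HasSum (fun n => ∑ p ∈ antidiagonal n, f p) a := by
  have h' := sigmaAntidiagonalEquivProd.hasSum_iff.mpr h
  refine (h'.sigma fun n => hasSum_fintype _).congr_fun fun n => ?_
  exact (Finset.sum_coe_sort (antidiagonal n) f).symm

theorem sum_antidiagonal_choose_mul_choose_pow (q : ℝ) (n : ℕ) :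
    ∑ p ∈ Finset.HasAntidiagonal.antidiagonal n,
      ((4 * p.1).choose p.1 : ℝ) * q ^ p.1 * (((3 * p.1).choose p.2 : ℝ) * (-q) ^ p.2)
      = (4 * q) ^ n := by
  have hn : ((∑ p ∈ Finset.HasAntidiagonal.antidiagonal n,
      (((4 * p.1).choose p.1 : ℤ) * ((3 * p.1).choose p.2) * (-1) ^ p.2) : ℤ) : ℝ) = 4 ^ n := by
    rw [sum_neg_one_pow_mul_choose_mul_choose]
    norm_num
  rw [mul_pow, ← hn, Int.cast_sum, Finset.sum_mul]
  refine Finset.sum_congr rfl fun p hp => ?_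
  rw [← Finset.HasAntidiagonal.mem_antidiagonal.mp hp, pow_add, neg_pow q]
  push_cast
  ring

/-- Expanding `(1 - q) ^ (3k)` gives a double series. Its row sums are the terms on the left, and
its antidiagonal sums form the geometric series of `4q`. -/
theorem hasSum_choose_four_mul_of_abs_le {q : ℝ} (hq : |q| ≤ 41 / 500) :
    HasSum (fun k : ℕ => ((4 * k).choose k : ℝ) * (q * (1 - q) ^ 3) ^ k) (1 / (1 - 4 * q)) := by
  have hsum := (summable_choose_mul_choose hq).hasSum
  have hgeom : HasSum (fun n : ℕ => (4 * q) ^ n) (1 / (1 - 4 * q)) := by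
    rw [one_div]
    refine hasSum_geometric_of_abs_lt_one ?_
    rw [abs_mul, abs_of_pos (by norm_num : (0 : ℝ) < 4)]
    linarith
  have hanti := hsum.sum_antidiagonal
  simp only [sum_antidiagonal_choose_mul_choose_pow] at hanti
  rw [hanti.unique hgeom] at hsum
  have hrow : ∀ k : ℕ, HasSum (fun j => ((4 * k).choose k : ℝ) * q ^ k *
      (((3 * k).choose j : ℝ) * (-q) ^ j))
      (((4 * k).choose k : ℝ) * (q * (1 - q) ^ 3) ^ k) := by
    intro k
    have h := (hasSum_choose_mul_pow (3 * k) (-q)).mul_left (((4 * k).choose k : ℝ) * q ^ k)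
    rwa [mul_assoc, pow_mul (1 + -q), ← mul_pow, ← sub_eq_add_neg] at h
  exact hsum.prod_fiberwise hrow

/-! ### Differentiating and integrating power series in `x = (y - 1) / y ^ 4`. -/

open Set

/-- This replaces integration: derivatives are compared only in the open interval, so formulas for
them that degenerate at an endpoint are harmless. -/
theorem sub_eq_sub_of_hasDerivAt_eq {f g f' : ℝ → ℝ} {a b : ℝ} (hab : a < b)
    (hf : ContinuousOn f (Icc a b)) (hg : ContinuousOn g (Icc a b))
    (hf' : ∀ x ∈ Ioo a b, HasDerivAt f (f' x) x) (hg' : ∀ x ∈ Ioo a b, HasDerivAt g (f' x) x) :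
    f b - f a = g b - g a := by
  obtain ⟨c, -, hc⟩ := exists_hasDerivAt_eq_slope (f - g) (fun _ => 0) hab (hf.sub hg)
    fun x hx => by simpa using (hf' x hx).sub (hg' x hx)
  rw [eq_div_iff (sub_pos.mpr hab).ne', zero_mul] at hc
  simp only [Pi.sub_apply] at hc
  linarith

/-- On this interval the substitution `x = (y - 1) / y ^ 4` inverts `y = 1 + x * y ^ 4`. -/
def substDomain : Set ℝ := Ioo (19 / 20) (1089 / 1000)

theorem hasDerivAt_subst {y : ℝ} (hy : y ≠ 0) :
    HasDerivAt (fun y : ℝ => (y - 1) / y ^ 4) ((4 - 3 * y) / y ^ 5) y := by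
  refine (((hasDerivAt_id y).sub_const 1).div (hasDerivAt_pow 4 y) (by positivity)).congr_deriv ?_
  simp only [id]
  field_simp
  ring

theorem abs_subst_le {y : ℝ} (hy : y ∈ substDomain) : |(y - 1) / y ^ 4| ≤ 13 / 200 := by
  obtain ⟨h1, h2⟩ := hy
  have hpos : 0 < y := by linarith
  have h4 : (19 / 20 : ℝ) ^ 4 ≤ y ^ 4 := by gcongr
  rw [abs_div, abs_of_pos (pow_pos hpos 4), div_le_iff₀ (pow_pos hpos 4), abs_le]
  constructor
  · norm_num at h4
    linarith
  · nlinarith [sq_nonneg (y ^ 2 - 1), sq_nonneg (y - 1), mul_pos hpos hpos,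
      sq_nonneg (y ^ 2 - 1), sq_nonneg (y - 1089 / 1000), sq_nonneg (y ^ 2 - (1089 / 1000) ^ 2)]

theorem abs_deriv_subst_le {y : ℝ} (hy : y ∈ substDomain) : |(4 - 3 * y) / y ^ 5| ≤ 2 := by
  obtain ⟨h1, h2⟩ := hy
  have hpos : 0 < y := by linarith
  have h5 : (19 / 20 : ℝ) ^ 5 ≤ y ^ 5 := by gcongr
  rw [abs_div, abs_of_pos (pow_pos hpos 5), div_le_iff₀ (pow_pos hpos 5),
    abs_of_pos (by linarith)]
  norm_num at h5
  linarith

theorem hasSum_choose_subst {y : ℝ} (hy : y ∈ substDomain) :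
    HasSum (fun k : ℕ => ((4 * k).choose k : ℝ) * ((y - 1) / y ^ 4) ^ k) (y / (4 - 3 * y)) := by
  obtain ⟨h1, h2⟩ := hy
  have hpos : 0 < y := by linarith
  have h4 : 4 - 3 * y ≠ 0 := by linarith
  -- The choice `q = 1 - 1 / y` turns `q (1 - q) ^ 3` into `(y - 1) / y ^ 4`.
  have hq : |1 - 1 / y| ≤ 41 / 500 := by
    rw [show 1 - 1 / y = (y - 1) / y by field_simp, abs_div, abs_of_pos hpos, div_le_iff₀ hpos,
      abs_le]
    constructor <;> linarith
  have h := hasSum_choose_four_mul_of_abs_le hq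
  have e1 : (1 - 1 / y) * (1 - (1 - 1 / y)) ^ 3 = (y - 1) / y ^ 4 := by
    field_simp
    ring
  have e2 : 1 / (1 - 4 * (1 - 1 / y)) = y / (4 - 3 * y) := by
    rw [show 1 - 4 * (1 - 1 / y) = (4 - 3 * y) / y by field_simp; ring, one_div_div]
  rwa [e1, e2] at h

section PowerSeries

variable {b : ℕ → ℝ} {j : ℕ}

theorem summable_deriv_bound (j : ℕ) : Summable fun k : ℕ =>
    ((k : ℝ) ^ j * (256 / 27) ^ k) * (k * (13 / 200) ^ (k - 1) * 2) := by
  -- The factor `400/13` is `2`, the bound on `dx/dy`, times `200/13`, which raises the exponent `k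
  -- - 1` to `k`.
  refine ((summable_pow_mul_geometric_of_norm_lt_one (j + 1) (r := (256 / 27 * (13 / 200) : ℝ))
    (by norm_num)).mul_left (400 / 13)).congr fun k => ?_
  rcases k with _ | k
  · simp
  · rw [mul_pow, Nat.add_sub_cancel, pow_succ (13 / 200 : ℝ) k]
    ring

theorem norm_deriv_term_le (hb : ∀ k, |b k| ≤ (k : ℝ) ^ j * (256 / 27) ^ k) (k : ℕ) {y : ℝ}
    (hy : y ∈ substDomain) :
    ‖b k * (k * ((y - 1) / y ^ 4) ^ (k - 1) * ((4 - 3 * y) / y ^ 5))‖ ≤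
      ((k : ℝ) ^ j * (256 / 27) ^ k) * (k * (13 / 200) ^ (k - 1) * 2) := by
  rw [Real.norm_eq_abs, abs_mul, abs_mul, abs_mul, Nat.abs_cast, abs_pow]
  have h1 := abs_subst_le hy
  have h2 := abs_deriv_subst_le hy
  have h3 := hb k
  gcongr

theorem hasDerivAt_tsum_subst (hb : ∀ k, |b k| ≤ (k : ℝ) ^ j * (256 / 27) ^ k) {y : ℝ}
    (hy : y ∈ substDomain) :
    HasDerivAt (fun y => ∑' k, b k * ((y - 1) / y ^ 4) ^ k)
      (∑' k, b k * (k * ((y - 1) / y ^ 4) ^ (k - 1) * ((4 - 3 * y) / y ^ 5))) y := by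
  -- At `y = 1` one has `x = 0`, so only the term `k = 0` survives and convergence there is trivial.
  refine hasDerivAt_tsum_of_isPreconnected (t := substDomain) (y₀ := 1) (summable_deriv_bound j)
    isOpen_Ioo isPreconnected_Ioo (fun k y hy => ?_) (fun k y hy => norm_deriv_term_le hb k hy)
    (by constructor <;> norm_num) ?_ hy
  · have hpos : 0 < y := lt_trans (by norm_num) hy.1
    exact ((hasDerivAt_subst hpos.ne').pow k).const_mul (b k)
  · refine summable_of_ne_finset_zero (s := {0}) fun k hk => ?_
    simp [zero_pow (by simpa using hk : k ≠ 0)]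

/-- The operator `x d/dx` multiplies the `k`-th coefficient by `k`. Since `dx/dy = (4 - 3y) / y ^
5`, it equals `(y - 1) y / (4 - 3y) * d/dy`. -/
theorem HasSum.deriv_subst (hb : ∀ k, |b k| ≤ (k : ℝ) ^ j * (256 / 27) ^ k) {F : ℝ → ℝ}
    (hF : ∀ y ∈ substDomain, HasSum (fun k => b k * ((y - 1) / y ^ 4) ^ k) (F y)) {y F' : ℝ}
    (hy : y ∈ substDomain) (hF' : HasDerivAt F F' y) :
    HasSum (fun k => k * b k * ((y - 1) / y ^ 4) ^ k) ((y - 1) * y / (4 - 3 * y) * F') := by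
  have hpos : 0 < y := lt_trans (by norm_num) hy.1
  have h4 : 4 - 3 * y ≠ 0 := by have := hy.2; linarith
  have h4' : 4 - y * 3 ≠ 0 := by rwa [mul_comm]
  have hderiv := (hasDerivAt_tsum_subst hb hy).congr_of_eventuallyEq (f₁ := F)
    (by filter_upwards [isOpen_Ioo.mem_nhds hy] with z hz using (hF z hz).tsum_eq.symm)
  have hs := (Summable.of_norm_bounded (summable_deriv_bound j)
    fun k => norm_deriv_term_le hb k hy).hasSum
  rw [hderiv.unique hF'] at hs
  refine (hs.mul_left ((y - 1) * y / (4 - 3 * y))).congr_fun fun k => ?_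
  rcases k with _ | k
  · simp
  · rw [Nat.add_sub_cancel, pow_succ]
    field_simp

end PowerSeries

theorem hasDerivAt_four_sub (y : ℝ) :
    HasDerivAt (fun y : ℝ => 4 - 3 * y) (-3) y := by
  simpa using ((hasDerivAt_id y).const_mul 3).const_sub 4

theorem abs_choose_four_mul_le (k : ℕ) :
    |((4 * k).choose k : ℝ)| ≤ (k : ℝ) ^ 0 * (256 / 27) ^ k := by
  rw [Nat.abs_cast, pow_zero, one_mul]
  exact choose_four_mul_le k

theorem abs_mul_choose_four_mul_le (k : ℕ) :
    |(k : ℝ) * ((4 * k).choose k : ℝ)| ≤ (k : ℝ) ^ 1 * (256 / 27) ^ k := by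
  rw [abs_mul, Nat.abs_cast, Nat.abs_cast, pow_one]
  exact mul_le_mul_of_nonneg_left (choose_four_mul_le k) k.cast_nonneg

theorem hasSum_mul_choose_subst {y : ℝ} (hy : y ∈ substDomain) :
    HasSum (fun k : ℕ => (k : ℝ) * ((4 * k).choose k : ℝ) * ((y - 1) / y ^ 4) ^ k)
      (4 * (y - 1) * y / (4 - 3 * y) ^ 3) := by
  have h4 : 4 - 3 * y ≠ 0 := by have := hy.2; linarith
  have h4' : 4 - y * 3 ≠ 0 := by rwa [mul_comm]
  have h := HasSum.deriv_subst abs_choose_four_mul_le (fun y hy => hasSum_choose_subst hy) hy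
    ((hasDerivAt_id y).div (hasDerivAt_four_sub y) h4)
  convert! h using 1
  simp only [id]
  field_simp
  ring

theorem hasSum_sq_mul_choose_subst {y : ℝ} (hy : y ∈ substDomain) :
    HasSum (fun k : ℕ => (k : ℝ) * (k * ((4 * k).choose k : ℝ)) * ((y - 1) / y ^ 4) ^ k)
      (4 * (y - 1) * (3 * y ^ 2 + 2 * y - 4) * y / (4 - 3 * y) ^ 5) := by
  have h4 : 4 - 3 * y ≠ 0 := by have := hy.2; linarith
  have h4' : 4 - y * 3 ≠ 0 := by rwa [mul_comm]
  have h := HasSum.deriv_subst abs_mul_choose_four_mul_le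
    (fun y hy => hasSum_mul_choose_subst hy) hy
    (((((hasDerivAt_id y).sub_const 1).const_mul 4).mul (hasDerivAt_id y)).div
      ((hasDerivAt_four_sub y).pow 3) (pow_ne_zero 3 h4))
  convert! h using 1
  simp only [id, Pi.mul_apply]
  field_simp
  ring

/-- Both sides vanish at `y = 1` and have derivative `(y / (4 - 3y) - 1) / x * dx/dy = 4 / y`. The
term `k = 0` is `0`, by the convention for division by zero. -/
theorem hasSum_choose_div_subst {y : ℝ} (hy1 : 1 < y) (hy2 : y < 1089 / 1000) :
    HasSum (fun k : ℕ => ((4 * k).choose k : ℝ) / k * ((y - 1) / y ^ 4) ^ k)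
      (4 * Real.log y) := by
  have hb : ∀ k : ℕ, |((4 * k).choose k : ℝ) / k| ≤ (k : ℝ) ^ 0 * (256 / 27) ^ k := by
    intro k
    rw [abs_div, Nat.abs_cast, Nat.abs_cast, pow_zero, one_mul]
    rcases Nat.eq_zero_or_pos k with rfl | hk
    · simp
    · exact (div_le_self (Nat.cast_nonneg _) (by exact_mod_cast hk)).trans (choose_four_mul_le k)
  have hmem : ∀ z ∈ Icc 1 y, z ∈ substDomain := fun z hz =>
    ⟨lt_of_lt_of_le (by norm_num) hz.1, lt_of_le_of_lt hz.2 hy2⟩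
  have hsummable : Summable fun k : ℕ => ((4 * k).choose k : ℝ) / k * ((y - 1) / y ^ 4) ^ k := by
    refine Summable.of_norm_bounded (hasSum_choose_subst (hmem y ⟨hy1.le, le_rfl⟩)).summable
      fun k => ?_
    have hx : 0 ≤ (y - 1) / y ^ 4 := div_nonneg (by linarith) (by positivity)
    rw [Real.norm_of_nonneg (by positivity)]
    refine mul_le_mul_of_nonneg_right ?_ (by positivity)
    rcases Nat.eq_zero_or_pos k with rfl | hk
    · simp
    · exact div_le_self (Nat.cast_nonneg _) (by exact_mod_cast hk)
  have hderiv : ∀ z ∈ Ioo 1 y, HasDerivAt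
      (fun z => ∑' k : ℕ, ((4 * k).choose k : ℝ) / k * ((z - 1) / z ^ 4) ^ k) (4 / z) z := by
    intro z hz
    have hzd := hmem z ⟨hz.1.le, hz.2.le⟩
    refine (hasDerivAt_tsum_subst hb hzd).congr_deriv ?_
    have hz0 : 0 < z := by linarith [hz.1]
    have hz1 : z - 1 ≠ 0 := by linarith [hz.1]
    have h4 : 4 - 3 * z ≠ 0 := by linarith [hzd.2]
    have h4' : 4 - z * 3 ≠ 0 := by rwa [mul_comm]
    -- The term `k = 0` is dropped so that the rest can be divided by `x`.
    have h := (hasSum_nat_add_iff' 1).mpr (hasSum_choose_subst hzd)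
    have hs : HasSum (fun k : ℕ => ((4 * k).choose k : ℝ) / k *
        (k * ((z - 1) / z ^ 4) ^ (k - 1) * ((4 - 3 * z) / z ^ 5))) (4 / z) := by
      rw [← hasSum_nat_add_iff' 1]
      convert! h.mul_left ((4 - 3 * z) / ((z - 1) * z)) using 1
      · ext k
        rw [Nat.add_sub_cancel, pow_succ (_ / _)]
        field_simp
      · simp only [Finset.range_one, Finset.sum_singleton]
        norm_num
        field_simp
        ring
    exact hs.tsum_eq
  have hcont : ContinuousOn
      (fun z => ∑' k : ℕ, ((4 * k).choose k : ℝ) / k * ((z - 1) / z ^ 4) ^ k) (Icc 1 y) :=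
    fun z hz => (hasDerivAt_tsum_subst hb (hmem z hz)).continuousAt.continuousWithinAt
  have hlog : ∀ z ∈ Icc 1 y, HasDerivAt (fun z => 4 * Real.log z) (4 / z) z := fun z hz => by
    simpa [div_eq_mul_inv] using
      (Real.hasDerivAt_log (by linarith [hz.1] : z ≠ 0)).const_mul 4
  have h := sub_eq_sub_of_hasDerivAt_eq hy1 hcont
    (fun z hz => (hlog z hz).continuousAt.continuousWithinAt) hderiv
    (fun z hz => hlog z ⟨hz.1.le, hz.2.le⟩)
  have h0 : ∑' k : ℕ, ((4 * k).choose k : ℝ) / k * (((1 : ℝ) - 1) / 1 ^ 4) ^ k = 0 := by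
    refine (tsum_congr fun k => ?_).trans tsum_zero
    rcases k with _ | k <;> simp
  simp only [h0, Real.log_one, mul_zero, sub_zero] at h
  exact h ▸ hsummable.hasSum

/-! ### Harmonic sums as values at `t = 1` of a primitive. -/

/-- The primitive of `1 + t + ⋯ + t ^ (n - 1)` vanishing at `0`; its value at `1` is `H n`. -/
noncomputable def harmonicPoly (n : ℕ) (t : ℝ) : ℝ :=
  ∑ i ∈ Finset.range n, t ^ (i + 1) / ((i : ℝ) + 1)

theorem harmonicPoly_zero_right (n : ℕ) : harmonicPoly n 0 = 0 := by simp [harmonicPoly]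

theorem harmonicPoly_one_right (n : ℕ) : harmonicPoly n 1 = H n := by
  simp [harmonicPoly, H, harmonic]

theorem hasDerivAt_harmonicPoly (n : ℕ) (t : ℝ) :
    HasDerivAt (harmonicPoly n) (∑ i ∈ Finset.range n, t ^ i) t := by
  refine HasDerivAt.fun_sum fun i _ => ?_
  refine ((hasDerivAt_pow (i + 1) t).div_const ((i : ℝ) + 1)).congr_deriv ?_
  have h : (i : ℝ) + 1 ≠ 0 := by positivity
  push_cast
  field_simp

theorem abs_harmonicPoly_le (n : ℕ) {t : ℝ} (h0 : 0 ≤ t) (h1 : t ≤ 1) :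
    |harmonicPoly n t| ≤ n := by
  refine (Finset.abs_sum_le_sum_abs _ _).trans ?_
  refine (Finset.sum_le_card_nsmul _ _ 1 fun i _ => ?_).trans (by simp)
  rw [abs_of_nonneg (by positivity), div_le_one (by positivity)]
  exact (pow_le_one₀ h0 h1).trans (by linarith [(Nat.cast_nonneg i : (0 : ℝ) ≤ i)])

section HarmonicSeries

variable {a : ℕ → ℝ}

theorem summable_abs_mul_mul (ha : Summable fun k => |a k| * (k : ℝ)) (m : ℕ) :
    Summable fun k : ℕ => |a k| * ((m * k : ℕ) : ℝ) := by
  refine (ha.mul_left (m : ℝ)).congr fun k => ?_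
  push_cast
  ring

theorem norm_mul_harmonicPoly_le (m k : ℕ) {t : ℝ} (ht : t ∈ Icc (0 : ℝ) 1) :
    ‖a k * harmonicPoly (m * k) t‖ ≤ |a k| * ((m * k : ℕ) : ℝ) := by
  rw [Real.norm_eq_abs, abs_mul]
  exact mul_le_mul_of_nonneg_left (abs_harmonicPoly_le _ ht.1 ht.2) (abs_nonneg _)

theorem continuousOn_tsum_harmonicPoly (ha : Summable fun k => |a k| * (k : ℝ)) (m : ℕ) :
    ContinuousOn (fun t => ∑' k, a k * harmonicPoly (m * k) t) (Icc 0 1) :=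
  continuousOn_tsum
    (fun k t _ => ((hasDerivAt_harmonicPoly (m * k) t).continuousAt.const_mul
      (a k)).continuousWithinAt)
    (summable_abs_mul_mul ha m) fun k _ ht => norm_mul_harmonicPoly_le m k ht

/-- Termwise, the derivative is the geometric sum `(1 - t ^ (m * k)) / (1 - t)`. -/
theorem hasDerivAt_tsum_harmonicPoly (ha : Summable fun k => |a k| * (k : ℝ)) (m : ℕ) {A B t : ℝ}
    (ht : t ∈ Ioo (0 : ℝ) 1) (hA : HasSum a A) (hB : HasSum (fun k => a k * (t ^ m) ^ k) B) :
    HasDerivAt (fun t => ∑' k, a k * harmonicPoly (m * k) t) ((A - B) / (1 - t)) t := by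
  have hderiv : HasDerivAt (fun t => ∑' k, a k * harmonicPoly (m * k) t)
      (∑' k, a k * ∑ i ∈ Finset.range (m * k), t ^ i) t := by
    refine hasDerivAt_tsum_of_isPreconnected (t := Ioo 0 1) (y₀ := t) (summable_abs_mul_mul ha m)
      isOpen_Ioo isPreconnected_Ioo
      (fun k s _ => (hasDerivAt_harmonicPoly (m * k) s).const_mul (a k)) (fun k s hs => ?_) ht
      (Summable.of_norm_bounded (summable_abs_mul_mul ha m)
        fun k => norm_mul_harmonicPoly_le m k ⟨ht.1.le, ht.2.le⟩) ht
    rw [Real.norm_eq_abs, abs_mul]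
    refine mul_le_mul_of_nonneg_left ?_ (abs_nonneg _)
    refine (Finset.abs_sum_le_sum_abs _ _).trans
      ((Finset.sum_le_card_nsmul _ _ 1 fun i _ => ?_).trans (by simp))
    rw [abs_of_nonneg (pow_nonneg hs.1.le i)]
    exact pow_le_one₀ hs.1.le hs.2.le
  refine hderiv.congr_deriv (HasSum.tsum_eq (((hA.sub hB).div_const (1 - t)).congr_fun fun k => ?_))
  rw [geom_sum_eq ht.2.ne, pow_mul]
  have h1 : t - 1 ≠ 0 := by linarith [ht.2]
  have h2 : 1 - t ≠ 0 := by linarith [ht.2]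
  field_simp
  ring

end HarmonicSeries

/-! ### The point `x = 1/16` and reduction to explicit primitives. -/

/-- The sum of `P k * (4 * k).choose k * x ^ k` at `x = (y - 1) / y ^ 4`. -/
noncomputable def sumP (y : ℝ) : ℝ :=
  22 * (4 * (y - 1) * (3 * y ^ 2 + 2 * y - 4) * y / (4 - 3 * y) ^ 5)
    - 92 * (4 * (y - 1) * y / (4 - 3 * y) ^ 3) + 11 * (y / (4 - 3 * y))

theorem hasSum_P_mul_choose_subst {y : ℝ} (hy : y ∈ substDomain) :
    HasSum (fun k : ℕ => P k * ((4 * k).choose k : ℝ) * ((y - 1) / y ^ 4) ^ k) (sumP y) := by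
  refine ((((hasSum_sq_mul_choose_subst hy).mul_left 22).sub
    ((hasSum_mul_choose_subst hy).mul_left 92)).add
    ((hasSum_choose_subst hy).mul_left 11)).congr_fun fun k => ?_
  rw [P]
  ring

/-- For `y = 2w`, the equation `x = 1/16` becomes `w ^ 4 - 2w + 1 = (w - 1) (w ^ 3 + w ^ 2 + w - 1)
= 0`; the numerical bounds put `2w` in `substDomain`. -/
theorem exists_tribonacci_root :
    ∃ w : ℝ, w ^ 3 + w ^ 2 + w = 1 ∧ 543 / 1000 < w ∧ w < 544 / 1000 := by
  have hc : ContinuousOn (fun w : ℝ => w ^ 3 + w ^ 2 + w) (Icc (543 / 1000) (544 / 1000)) := by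
    fun_prop
  obtain ⟨w, hw, h⟩ := intermediate_value_Ioo (by norm_num) hc
    (show (1 : ℝ) ∈ Ioo _ _ by constructor <;> norm_num)
  exact ⟨w, h, hw.1, hw.2⟩

section Root

variable {w : ℝ}

theorem two_mul_root_mem (h1 : 543 / 1000 < w) (h2 : w < 544 / 1000) : 2 * w ∈ substDomain :=
  ⟨by linarith, by linarith⟩

theorem subst_root (hw : w ^ 3 + w ^ 2 + w = 1) (h1 : 543 / 1000 < w) :
    (2 * w - 1) / (2 * w) ^ 4 = 1 / 16 := by
  have h : w ≠ 0 := by linarith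
  field_simp
  linear_combination (16 * (1 - w)) * hw

theorem inv_four_sub_root (hw : w ^ 3 + w ^ 2 + w = 1) (h2 : w < 544 / 1000) :
    1 / (4 - 3 * (2 * w)) = (19 + 15 * w + 9 * w ^ 2) / 22 := by
  have h : 4 - 3 * (2 * w) ≠ 0 := by linarith
  rw [div_eq_iff h]
  linear_combination (54 / 22) * hw

theorem sumP_root (hw : w ^ 3 + w ^ 2 + w = 1) (h2 : w < 544 / 1000) : sumP (2 * w) = -5 := by
  have h := inv_four_sub_root hw h2
  rw [one_div] at h
  simp only [sumP, div_eq_mul_inv, ← inv_pow, h]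
  grind

end Root

/-- The integral of `(A - B(t)) / (1 - t)` over `[0, 1]`, pulled back along `t = t(u)`. It remains
to supply the parametrization and a primitive `Φ` of the pulled-back integrand. -/
theorem hasSum_P_mul_harmonic_of_primitive {w : ℝ} (hw : w ^ 3 + w ^ 2 + w = 1)
    (h1 : 543 / 1000 < w) (h2 : w < 544 / 1000) {m : ℕ} {u₀ u₁ : ℝ} (hu : u₀ < u₁)
    {y t t' Φ : ℝ → ℝ} (hy : ∀ u ∈ Ioo u₀ u₁, y u ∈ Ioo 1 (2 * w))
    (ht0 : ∀ u ∈ Ioo u₀ u₁, 0 < t u)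
    (hty : ∀ u ∈ Ioo u₀ u₁, t u ^ m = 16 * ((y u - 1) / y u ^ 4))
    (htc : ContinuousOn t (Icc u₀ u₁)) (ht' : ∀ u ∈ Ioo u₀ u₁, HasDerivAt t (t' u) u)
    (htu₀ : t u₀ = 0) (htu₁ : t u₁ = 1) (hΦc : ContinuousOn Φ (Icc u₀ u₁))
    (hΦ : ∀ u ∈ Ioo u₀ u₁, t u < 1 →
      HasDerivAt Φ ((-5 - sumP (y u)) / (1 - t u) * t' u) u) :
    HasSum (fun k : ℕ => ((4 * k).choose k : ℝ) / 16 ^ k * (P k * H (m * k))) (Φ u₁ - Φ u₀) := by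
  set a : ℕ → ℝ := fun k => P k * ((4 * k).choose k : ℝ) * ((2 * w - 1) / (2 * w) ^ 4) ^ k
    with ha
  have hroot := two_mul_root_mem h1 h2
  have hx := subst_root hw h1
  have hA : HasSum a (-5) := sumP_root hw h2 ▸ hasSum_P_mul_choose_subst hroot
  have hs : Summable fun k => |a k| * (k : ℝ) := by
    refine Summable.of_norm_bounded ((summable_pow_mul_geometric_of_norm_lt_one 3
      (r := (16 / 27 : ℝ)) (by norm_num)).mul_left 125) fun k => ?_
    have hC : ((4 * k).choose k : ℝ) * (1 / 16) ^ k ≤ (16 / 27) ^ k := by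
      refine (mul_le_mul_of_nonneg_right (choose_four_mul_le k) (by positivity)).trans_eq ?_
      rw [← mul_pow]
      norm_num
    have hP : |P k| * k ≤ 125 * (k : ℝ) ^ 3 := by
      rcases Nat.eq_zero_or_pos k with rfl | hk
      · simp
      · have hk1 : (1 : ℝ) ≤ k := by exact_mod_cast hk
        -- `125 = 22 + 92 + 11`.
        have : |P k| ≤ 125 * (k : ℝ) ^ 2 := by
          rw [P, abs_le]
          constructor <;> nlinarith
        nlinarith
    rw [Real.norm_of_nonneg (by positivity), ha]
    simp only [hx]
    rw [mul_assoc, abs_mul, abs_of_nonneg (by positivity : 0 ≤ ((4 * k).choose k : ℝ) * _)]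
    calc |P k| * (((4 * k).choose k : ℝ) * (1 / 16) ^ k) * k
        = |P k| * k * (((4 * k).choose k : ℝ) * (1 / 16) ^ k) := by ring
      _ ≤ 125 * (k : ℝ) ^ 3 * (16 / 27) ^ k := by gcongr
      _ = _ := by ring
  -- The difference `y ^ 4 - 16 (y - 1)` factors as `(2 - y) (8 - 4y - 2y ^ 2 - y ^ 3)`, and the
  -- cubic is positive below its root `2w`.
  have ht1 : ∀ u ∈ Ioo u₀ u₁, t u < 1 := by
    intro u hu
    refine lt_of_pow_lt_pow_left₀ m zero_le_one ?_
    obtain ⟨hy1, hy2⟩ := hy u hu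
    have hy0 : 0 < y u := by linarith
    rw [hty u hu, one_pow, ← mul_div_assoc, div_lt_one (by positivity)]
    have h3 : y u ^ 3 + 2 * y u ^ 2 + 4 * y u < 8 := by
      have h4 : y u ^ 3 + 2 * y u ^ 2 + 4 * y u
          < (2 * w) ^ 3 + 2 * (2 * w) ^ 2 + 4 * (2 * w) := by gcongr
      linarith
    nlinarith
  have hmaps : MapsTo t (Icc u₀ u₁) (Icc 0 1) := by
    intro u hu
    rcases eq_endpoints_or_mem_Ioo_of_mem_Icc hu with rfl | rfl | hu
    · simp [htu₀]
    · simp [htu₁]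
    · exact ⟨(ht0 u hu).le, (ht1 u hu).le⟩
  have hderiv : ∀ u ∈ Ioo u₀ u₁, HasDerivAt
      ((fun t => ∑' k, a k * harmonicPoly (m * k) t) ∘ t)
      ((-5 - sumP (y u)) / (1 - t u) * t' u) u := by
    intro u hu
    have hyu : y u ∈ substDomain :=
      ⟨by linarith [(hy u hu).1], by linarith [(hy u hu).2]⟩
    refine (hasDerivAt_tsum_harmonicPoly hs m ⟨ht0 u hu, ht1 u hu⟩ hA ?_).comp u (ht' u hu)
    refine (hasSum_P_mul_choose_subst hyu).congr_fun fun k => ?_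
    rw [hty u hu, ha]
    simp only [hx]
    rw [mul_assoc _ (_ ^ k), ← mul_pow, one_div_mul_eq_div, mul_div_cancel_left₀ _ (by norm_num)]
  have h := sub_eq_sub_of_hasDerivAt_eq hu
    ((continuousOn_tsum_harmonicPoly hs m).comp htc hmaps) hΦc hderiv
    fun u hu => hΦ u hu (ht1 u hu)
  simp only [Function.comp, htu₀, htu₁, harmonicPoly_zero_right, harmonicPoly_one_right, mul_zero,
    tsum_zero, sub_zero] at h
  have hsum : Summable fun k => a k * H (m * k) := by
    refine Summable.of_norm_bounded (summable_abs_mul_mul hs m) fun k => ?_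
    rw [← harmonicPoly_one_right]
    exact norm_mul_harmonicPoly_le m k ⟨zero_le_one, le_rfl⟩
  rw [← h]
  refine hsum.hasSum.congr_fun fun k => ?_
  rw [ha]
  simp only [hx]
  rw [div_pow, one_pow]
  ring

/-! ### Explicit primitives for `m = 1, 2, 3, 4`. -/

theorem hasDerivAt_div_pow_three {N D : ℝ → ℝ} {N' D' u : ℝ} (hN : HasDerivAt N N' u)
    (hD : HasDerivAt D D' u) (h : D u ≠ 0) :
    HasDerivAt (fun u => N u / D u ^ 3) ((N' * D u - 3 * N u * D') / D u ^ 4) u := by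
  refine (hN.fun_div (hD.fun_pow 3) (pow_ne_zero 3 h)).congr_deriv ?_
  field_simp
  norm_num
  ring

section Primitives

variable {w : ℝ}

/-- Here `u = y` and `t = 16 (u - 1) / u ^ 4`, with `u` from `1` to `2w`; the constant `144` is
`-Φ(1)`. -/
theorem hasSum_P_mul_harmonic_one (hw : w ^ 3 + w ^ 2 + w = 1) (h1 : 543 / 1000 < w)
    (h2 : w < 544 / 1000) :
    HasSum (fun k : ℕ => ((4 * k).choose k : ℝ) / 16 ^ k * (P k * H (1 * k)))
      ((-2304 + 3240 * (2 * w) - 1080 * (2 * w) ^ 2) / (4 - 3 * (2 * w)) ^ 3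
        - 20 * Real.log (2 * w) + 20 * Real.log (2 - 2 * w) + 144) := by
  have hderiv : ∀ u ∈ Icc 1 (2 * w), HasDerivAt
      (fun u => (-2304 + 3240 * u - 1080 * u ^ 2) / (4 - 3 * u) ^ 3
        - 20 * Real.log u + 20 * Real.log (2 - u))
      (((3240 - 2160 * u) * (4 - 3 * u) - 3 * (-2304 + 3240 * u - 1080 * u ^ 2) * (-3))
        / (4 - 3 * u) ^ 4 - 20 * u⁻¹ + 20 * (-1 / (2 - u))) u := by
    intro u hu
    have hN : HasDerivAt (fun u : ℝ => -2304 + 3240 * u - 1080 * u ^ 2) (3240 - 2160 * u) u := by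
      have h := (-2304 + 3240 * .X - 1080 * .X ^ 2 : Polynomial ℝ).hasDerivAt u
      simp at h
      convert! h using 1
      ring
    have hu0 : u ≠ 0 := by linarith [hu.1]
    have h4 : 4 - 3 * u ≠ 0 := by linarith [hu.2]
    have h2u : 2 - u ≠ 0 := by linarith [hu.2]
    exact ((hasDerivAt_div_pow_three hN (hasDerivAt_four_sub u) h4).sub
      ((Real.hasDerivAt_log hu0).const_mul 20)).add
      ((((hasDerivAt_id u).const_sub 2).log h2u).const_mul 20)
  have ht : ∀ u ∈ Icc 1 (2 * w), HasDerivAt (fun u : ℝ => 16 * ((u - 1) / u ^ 4))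
      (16 * ((4 - 3 * u) / u ^ 5)) u := fun u hu =>
    (hasDerivAt_subst (by linarith [hu.1])).const_mul 16
  have h := hasSum_P_mul_harmonic_of_primitive hw h1 h2 (m := 1) (y := fun u => u)
    (by linarith : 1 < 2 * w) (fun u hu => hu)
    (fun u hu => mul_pos (by norm_num) (div_pos (by linarith [hu.1])
      (pow_pos (by linarith [hu.1]) 4)))
    (fun u _ => pow_one _) (fun u hu => (ht u hu).continuousAt.continuousWithinAt)
    (fun u hu => ht u (Ioo_subset_Icc_self hu)) (by norm_num)
    (by rw [subst_root hw h1]; norm_num)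
    (fun u hu => (hderiv u hu).continuousAt.continuousWithinAt)
    (fun u hu htu => (hderiv u (Ioo_subset_Icc_self hu)).congr_deriv ?_)
  · convert! h using 1
    norm_num
  · have hu0 : u ≠ 0 := by linarith [hu.1]
    have h4 : 4 - 3 * u ≠ 0 := by linarith [hu.2]
    have h2u : 2 - u ≠ 0 := by linarith [hu.2]
    have h1t : 1 - 16 * ((u - 1) / u ^ 4)
        = (2 - u) * (8 - 4 * u - 2 * u ^ 2 - u ^ 3) / u ^ 4 := by
      field_simp
      ring
    -- A zero of the cubic would force `t = 1`.
    have hc : 8 - 4 * u - 2 * u ^ 2 - u ^ 3 ≠ 0 := by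
      intro hc
      rw [hc] at h1t
      simp only [mul_zero, zero_div] at h1t
      linarith
    rw [h1t, sumP]
    -- The denominators stay opaque atoms while they are cleared, and are expanded only for the
    -- final polynomial identity.
    generalize hC : 8 - 4 * u - 2 * u ^ 2 - u ^ 3 = C at hc ⊢
    generalize hD : 4 - 3 * u = D at h4 ⊢
    generalize hE : 2 - u = E at h2u ⊢
    field_simp
    rw [← hC, ← hD, ← hE]
    ring

/-- With `y = 1 + u ^ 2`, the square root is `t = 4u / y ^ 2`. The endpoint is `u = w ^ 2`, because
`w ^ 4 = 2w - 1`. -/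
theorem hasSum_P_mul_harmonic_two (hw : w ^ 3 + w ^ 2 + w = 1) (h1 : 543 / 1000 < w)
    (h2 : w < 544 / 1000) :
    HasSum (fun k : ℕ => ((4 * k).choose k : ℝ) / 16 ^ k * (P k * H (2 * k)))
      ((-72 - 44 * w ^ 2 + 540 * (w ^ 2) ^ 2 + 504 * (w ^ 2) ^ 3 - 540 * (w ^ 2) ^ 4
          - 540 * (w ^ 2) ^ 5) / (1 - 3 * (w ^ 2) ^ 2) ^ 3
        - 10 * Real.log (1 + (w ^ 2) ^ 2) + 20 * Real.log (1 - w ^ 2) + 72) := by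
  have hw4 : (w ^ 2) ^ 2 = 2 * w - 1 := by linear_combination (w - 1) * hw
  have hle : ∀ u ∈ Icc 0 (w ^ 2), u ^ 2 ≤ 2 * w - 1 := fun u hu => by
    rw [← hw4]
    exact pow_le_pow_left₀ hu.1 hu.2 2
  have hlt : ∀ u ∈ Ioo 0 (w ^ 2), u ^ 2 < 2 * w - 1 := fun u hu => by
    rw [← hw4]
    exact pow_lt_pow_left₀ hu.2 hu.1.le two_ne_zero
  have hlt1 : ∀ u ∈ Icc 0 (w ^ 2), u < 1 := fun u hu => by nlinarith [hu.2]
  have hderiv : ∀ u ∈ Icc 0 (w ^ 2), HasDerivAt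
      (fun u => (-72 - 44 * u + 540 * u ^ 2 + 504 * u ^ 3 - 540 * u ^ 4 - 540 * u ^ 5)
          / (1 - 3 * u ^ 2) ^ 3
        - 10 * Real.log (1 + u ^ 2) + 20 * Real.log (1 - u))
      (((-44 + 1080 * u + 1512 * u ^ 2 - 2160 * u ^ 3 - 2700 * u ^ 4) * (1 - 3 * u ^ 2)
          - 3 * (-72 - 44 * u + 540 * u ^ 2 + 504 * u ^ 3 - 540 * u ^ 4 - 540 * u ^ 5)
            * (-6 * u)) / (1 - 3 * u ^ 2) ^ 4
        - 10 * (2 * u / (1 + u ^ 2)) + 20 * (-1 / (1 - u))) u := by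
    intro u hu
    have hN : HasDerivAt
        (fun u : ℝ => -72 - 44 * u + 540 * u ^ 2 + 504 * u ^ 3 - 540 * u ^ 4 - 540 * u ^ 5)
        (-44 + 1080 * u + 1512 * u ^ 2 - 2160 * u ^ 3 - 2700 * u ^ 4) u := by
      have h := (-72 - 44 * .X + 540 * .X ^ 2 + 504 * .X ^ 3 - 540 * .X ^ 4 - 540 * .X ^ 5 :
        Polynomial ℝ).hasDerivAt u
      simp at h
      convert! h using 1
      ring
    have hD : HasDerivAt (fun u : ℝ => 1 - 3 * u ^ 2) (-6 * u) u :=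
      (((hasDerivAt_pow 2 u).const_mul 3).const_sub 1).congr_deriv (by norm_num; ring)
    have hY : HasDerivAt (fun u : ℝ => 1 + u ^ 2) (2 * u) u :=
      ((hasDerivAt_pow 2 u).const_add 1).congr_deriv (by norm_num)
    have h4 : 1 - 3 * u ^ 2 ≠ 0 := by linarith [hle u hu]
    exact ((hasDerivAt_div_pow_three hN hD h4).sub
      ((hY.log (by positivity)).const_mul 10)).add
      ((((hasDerivAt_id u).const_sub 1).log (sub_ne_zero.mpr (hlt1 u hu).ne')).const_mul 20)
  have ht : ∀ u ∈ Icc 0 (w ^ 2), HasDerivAt (fun u : ℝ => 4 * u / (1 + u ^ 2) ^ 2)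
      (4 * (1 - 3 * u ^ 2) / (1 + u ^ 2) ^ 3) u := by
    intro u _
    have hY : HasDerivAt (fun u : ℝ => 1 + u ^ 2) (2 * u) u :=
      ((hasDerivAt_pow 2 u).const_add 1).congr_deriv (by norm_num)
    refine (((hasDerivAt_id u).const_mul 4).fun_div (hY.fun_pow 2)
      (by positivity)).congr_deriv ?_
    simp only [id]
    field_simp
    norm_num
    ring
  have h := hasSum_P_mul_harmonic_of_primitive hw h1 h2 (m := 2) (y := fun u => 1 + u ^ 2)
    (by positivity : 0 < w ^ 2)
    (fun u hu => ⟨by nlinarith [hu.1], by linarith [hlt u hu]⟩)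
    (fun u hu => div_pos (by linarith [hu.1]) (by positivity))
    (fun u _ => by field_simp; ring) (fun u hu => (ht u hu).continuousAt.continuousWithinAt)
    (fun u hu => ht u (Ioo_subset_Icc_self hu)) (by norm_num)
    (by
      rw [hw4, div_eq_one_iff_eq (by nlinarith)]
      ring)
    (fun u hu => (hderiv u hu).continuousAt.continuousWithinAt)
    (fun u hu htu => (hderiv u (Ioo_subset_Icc_self hu)).congr_deriv ?_)
  · convert! h using 1
    norm_num
  · have h4 : 1 - 3 * u ^ 2 ≠ 0 := by linarith [hlt u hu]
    have h1u : 1 - u ≠ 0 := by linarith [hlt1 u (Ioo_subset_Icc_self hu)]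
    have h1t : 1 - 4 * u / (1 + u ^ 2) ^ 2
        = (1 - u) * (1 - 3 * u - u ^ 2 - u ^ 3) / (1 + u ^ 2) ^ 2 := by
      field_simp
      ring
    have hc : 1 - 3 * u - u ^ 2 - u ^ 3 ≠ 0 := by
      intro hc
      rw [hc] at h1t
      simp only [mul_zero, zero_div] at h1t
      linarith
    rw [h1t, sumP, show 4 - 3 * (1 + u ^ 2) = 1 - 3 * u ^ 2 by ring]
    have hY : 1 + u ^ 2 ≠ 0 := by positivity
    generalize hC : 1 - 3 * u - u ^ 2 - u ^ 3 = C at hc ⊢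
    generalize hD : 1 - 3 * u ^ 2 = D at h4 ⊢
    generalize hE : 1 - u = E at h1u ⊢
    field_simp
    rw [← hC, ← hD, ← hE]
    ring

/-- With `u ^ 3 = 16 (y - 1) / y`, that is `y = 16 / (16 - u ^ 3)`, the cube root is `t = u / y`.
The endpoint is `u = 2w`. -/
theorem hasSum_P_mul_harmonic_three (hw : w ^ 3 + w ^ 2 + w = 1) (h1 : 543 / 1000 < w)
    (h2 : w < 544 / 1000) :
    HasSum (fun k : ℕ => ((4 * k).choose k : ℝ) / 16 ^ k * (P k * H (3 * k)))
      ((-147456 - 24576 * (2 * w) - 22528 * (2 * w) ^ 2 + 92160 * (2 * w) ^ 3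
          + 22528 * (2 * w) ^ 4 + 20480 * (2 * w) ^ 5 - 10368 * (2 * w) ^ 6 - 2560 * (2 * w) ^ 7 - 2560 * (2 * w) ^ 8)
          / (16 - 4 * (2 * w) ^ 3) ^ 3
        + 20 * Real.log (2 - 2 * w) - (-36 + 20 * Real.log 2)) := by
  have hw4 : 2 * w * (16 - (2 * w) ^ 3) = 16 := by linear_combination (16 - 16 * w) * hw
  have hle : ∀ u ∈ Icc 0 (2 * w), u ^ 3 ≤ (2 * w) ^ 3 := fun u hu =>
    pow_le_pow_left₀ hu.1 hu.2 3
  have hlt : ∀ u ∈ Ioo 0 (2 * w), u ^ 3 < (2 * w) ^ 3 := fun u hu =>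
    pow_lt_pow_left₀ hu.2 hu.1.le three_ne_zero
  have hcube : (2 * w) ^ 3 < 2 := by nlinarith
  have hderiv : ∀ u ∈ Icc 0 (2 * w), HasDerivAt
      (fun u => (-147456 - 24576 * u - 22528 * u ^ 2 + 92160 * u ^ 3 + 22528 * u ^ 4
          + 20480 * u ^ 5 - 10368 * u ^ 6 - 2560 * u ^ 7 - 2560 * u ^ 8)
          / (16 - 4 * u ^ 3) ^ 3 + 20 * Real.log (2 - u))
      (((-24576 - 45056 * u + 276480 * u ^ 2 + 90112 * u ^ 3 + 102400 * u ^ 4 - 62208 * u ^ 5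
          - 17920 * u ^ 6 - 20480 * u ^ 7) * (16 - 4 * u ^ 3)
          - 3 * (-147456 - 24576 * u - 22528 * u ^ 2 + 92160 * u ^ 3 + 22528 * u ^ 4
              + 20480 * u ^ 5 - 10368 * u ^ 6 - 2560 * u ^ 7 - 2560 * u ^ 8)
            * (-12 * u ^ 2)) / (16 - 4 * u ^ 3) ^ 4 + 20 * (-1 / (2 - u))) u := by
    intro u hu
    have hN : HasDerivAt
        (fun u : ℝ => -147456 - 24576 * u - 22528 * u ^ 2 + 92160 * u ^ 3 + 22528 * u ^ 4
            + 20480 * u ^ 5 - 10368 * u ^ 6 - 2560 * u ^ 7 - 2560 * u ^ 8)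
        (-24576 - 45056 * u + 276480 * u ^ 2 + 90112 * u ^ 3 + 102400 * u ^ 4 - 62208 * u ^ 5
            - 17920 * u ^ 6 - 20480 * u ^ 7) u := by
      have h := (-147456 - 24576 * .X - 22528 * .X ^ 2 + 92160 * .X ^ 3 + 22528 * .X ^ 4
          + 20480 * .X ^ 5 - 10368 * .X ^ 6 - 2560 * .X ^ 7 - 2560 * .X ^ 8 :
        Polynomial ℝ).hasDerivAt u
      simp at h
      convert! h using 1
      ring
    have hD : HasDerivAt (fun u : ℝ => 16 - 4 * u ^ 3) (-12 * u ^ 2) u :=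
      (((hasDerivAt_pow 3 u).const_mul 4).const_sub 16).congr_deriv (by norm_num; ring)
    have h4 : 16 - 4 * u ^ 3 ≠ 0 := by linarith [hle u hu]
    have h2u : 2 - u ≠ 0 := by linarith [hu.2]
    exact (hasDerivAt_div_pow_three hN hD h4).add
      ((((hasDerivAt_id u).const_sub 2).log h2u).const_mul 20)
  have ht : ∀ u ∈ Icc 0 (2 * w), HasDerivAt (fun u : ℝ => u * (16 - u ^ 3) / 16)
      ((16 - 4 * u ^ 3) / 16) u := by
    intro u _
    refine (((hasDerivAt_id u).fun_mul ((hasDerivAt_pow 3 u).const_sub 16)).div_const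
      16).congr_deriv ?_
    simp only [id]
    norm_num
    ring
  have h := hasSum_P_mul_harmonic_of_primitive hw h1 h2 (m := 3)
    (y := fun u => 16 / (16 - u ^ 3)) (by linarith : 0 < 2 * w)
    (fun u hu => by
      have hE : 0 < 16 - u ^ 3 := by linarith [hlt u hu]
      have hu3 : 0 < u ^ 3 := pow_pos hu.1 3
      rw [mem_Ioo, one_lt_div hE, div_lt_iff₀ hE]
      constructor
      · linarith
      · nlinarith [hlt u hu])
    (fun u hu => div_pos (mul_pos hu.1 (by linarith [hlt u hu])) (by norm_num))
    (fun u hu => by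
      have hE : 16 - u ^ 3 ≠ 0 := by linarith [hlt u hu]
      generalize hE' : 16 - u ^ 3 = E at hE ⊢
      field_simp
      rw [← hE']
      ring)
    (fun u hu => (ht u hu).continuousAt.continuousWithinAt)
    (fun u hu => ht u (Ioo_subset_Icc_self hu)) (by norm_num) (by rw [hw4]; norm_num)
    (fun u hu => (hderiv u hu).continuousAt.continuousWithinAt)
    (fun u hu htu => (hderiv u (Ioo_subset_Icc_self hu)).congr_deriv ?_)
  · convert! h using 1
    norm_num
  · have h4 : 16 - 4 * u ^ 3 ≠ 0 := by linarith [hlt u hu]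
    have hE : 16 - u ^ 3 ≠ 0 := by linarith [hlt u hu]
    have h2u : 2 - u ≠ 0 := by linarith [hu.2]
    have h1t : 1 - u * (16 - u ^ 3) / 16
        = (2 - u) * (8 - 4 * u - 2 * u ^ 2 - u ^ 3) / 16 := by
      ring
    have hc : 8 - 4 * u - 2 * u ^ 2 - u ^ 3 ≠ 0 := by
      intro hc
      rw [hc] at h1t
      simp only [mul_zero, zero_div] at h1t
      linarith
    have hY : 4 - 3 * (16 / (16 - u ^ 3)) = (16 - 4 * u ^ 3) / (16 - u ^ 3) := by
      rw [eq_div_iff hE, sub_mul, mul_assoc, div_mul_cancel₀ _ hE]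
      ring
    rw [h1t, sumP, hY]
    generalize hC : 8 - 4 * u - 2 * u ^ 2 - u ^ 3 = C at hc ⊢
    generalize hD : 16 - 4 * u ^ 3 = D at h4 ⊢
    generalize hE' : 16 - u ^ 3 = E at hE ⊢
    generalize hF : 2 - u = F at h2u ⊢
    field_simp
    rw [← hC, ← hD, ← hE', ← hF]
    ring

/-- With `y = 1 + u ^ 4`, the fourth root is `t = 2u / y`. The endpoint is `u = w`. -/
theorem hasSum_P_mul_harmonic_four (hw : w ^ 3 + w ^ 2 + w = 1) (h1 : 543 / 1000 < w)
    (h2 : w < 544 / 1000) :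
    HasSum (fun k : ℕ => ((4 * k).choose k : ℝ) / 16 ^ k * (P k * H (4 * k)))
      ((-36 - 12 * w - 22 * w ^ 2 - 36 * w ^ 3 + 270 * w ^ 4 + 136 * w ^ 5 + 252 * w ^ 6
          + 432 * w ^ 7 - 270 * w ^ 8 - 108 * w ^ 9 - 270 * w ^ 10 - 540 * w ^ 11)
          / (1 - 3 * w ^ 4) ^ 3
        - 5 * Real.log (1 + w ^ 4) + 20 * Real.log (1 - w) + 36) := by
  have hw4 : w ^ 4 = 2 * w - 1 := by linear_combination (w - 1) * hw
  have hle : ∀ u ∈ Icc 0 w, u ^ 4 ≤ 2 * w - 1 := fun u hu => by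
    rw [← hw4]
    exact pow_le_pow_left₀ hu.1 hu.2 4
  have hlt : ∀ u ∈ Ioo 0 w, u ^ 4 < 2 * w - 1 := fun u hu => by
    rw [← hw4]
    exact pow_lt_pow_left₀ hu.2 hu.1.le four_ne_zero
  have hderiv : ∀ u ∈ Icc 0 w, HasDerivAt
      (fun u => (-36 - 12 * u - 22 * u ^ 2 - 36 * u ^ 3 + 270 * u ^ 4 + 136 * u ^ 5
          + 252 * u ^ 6 + 432 * u ^ 7 - 270 * u ^ 8 - 108 * u ^ 9 - 270 * u ^ 10 - 540 * u ^ 11)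
          / (1 - 3 * u ^ 4) ^ 3
        - 5 * Real.log (1 + u ^ 4) + 20 * Real.log (1 - u))
      (((-12 - 44 * u - 108 * u ^ 2 + 1080 * u ^ 3 + 680 * u ^ 4 + 1512 * u ^ 5 + 3024 * u ^ 6
          - 2160 * u ^ 7 - 972 * u ^ 8 - 2700 * u ^ 9 - 5940 * u ^ 10)
            * (1 - 3 * u ^ 4)
          - 3 * (-36 - 12 * u - 22 * u ^ 2 - 36 * u ^ 3 + 270 * u ^ 4 + 136 * u ^ 5
              + 252 * u ^ 6 + 432 * u ^ 7 - 270 * u ^ 8 - 108 * u ^ 9 - 270 * u ^ 10 - 540 * u ^ 11)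
            * (-12 * u ^ 3)) / (1 - 3 * u ^ 4) ^ 4
        - 5 * (4 * u ^ 3 / (1 + u ^ 4)) + 20 * (-1 / (1 - u))) u := by
    intro u hu
    have hN : HasDerivAt
        (fun u : ℝ => -36 - 12 * u - 22 * u ^ 2 - 36 * u ^ 3 + 270 * u ^ 4 + 136 * u ^ 5
            + 252 * u ^ 6 + 432 * u ^ 7 - 270 * u ^ 8 - 108 * u ^ 9 - 270 * u ^ 10 - 540 * u ^ 11)
        (-12 - 44 * u - 108 * u ^ 2 + 1080 * u ^ 3 + 680 * u ^ 4 + 1512 * u ^ 5 + 3024 * u ^ 6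
            - 2160 * u ^ 7 - 972 * u ^ 8 - 2700 * u ^ 9 - 5940 * u ^ 10) u := by
      have h := (-36 - 12 * .X - 22 * .X ^ 2 - 36 * .X ^ 3 + 270 * .X ^ 4 + 136 * .X ^ 5
          + 252 * .X ^ 6 + 432 * .X ^ 7 - 270 * .X ^ 8 - 108 * .X ^ 9 - 270 * .X ^ 10 - 540 * .X ^ 11 :
        Polynomial ℝ).hasDerivAt u
      simp at h
      convert! h using 1
      ring
    have hD : HasDerivAt (fun u : ℝ => 1 - 3 * u ^ 4) (-12 * u ^ 3) u :=
      (((hasDerivAt_pow 4 u).const_mul 3).const_sub 1).congr_deriv (by norm_num; ring)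
    have hY : HasDerivAt (fun u : ℝ => 1 + u ^ 4) (4 * u ^ 3) u :=
      ((hasDerivAt_pow 4 u).const_add 1).congr_deriv (by norm_num)
    have h4 : 1 - 3 * u ^ 4 ≠ 0 := by linarith [hle u hu]
    have h1u : 1 - u ≠ 0 := by linarith [hu.2]
    exact ((hasDerivAt_div_pow_three hN hD h4).sub
      ((hY.log (by positivity)).const_mul 5)).add
      ((((hasDerivAt_id u).const_sub 1).log h1u).const_mul 20)
  have ht : ∀ u ∈ Icc 0 w, HasDerivAt (fun u : ℝ => 2 * u / (1 + u ^ 4))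
      (2 * (1 - 3 * u ^ 4) / (1 + u ^ 4) ^ 2) u := by
    intro u _
    have hY : HasDerivAt (fun u : ℝ => 1 + u ^ 4) (4 * u ^ 3) u :=
      ((hasDerivAt_pow 4 u).const_add 1).congr_deriv (by norm_num)
    refine (((hasDerivAt_id u).const_mul 2).fun_div hY (by positivity)).congr_deriv ?_
    simp only [id]
    ring
  have h := hasSum_P_mul_harmonic_of_primitive hw h1 h2 (m := 4) (y := fun u => 1 + u ^ 4)
    (by linarith : 0 < w)
    (fun u hu => ⟨by linarith [pow_pos hu.1 4], by linarith [hlt u hu]⟩)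
    (fun u hu => div_pos (by linarith [hu.1]) (by positivity))
    (fun u _ => by field_simp; ring) (fun u hu => (ht u hu).continuousAt.continuousWithinAt)
    (fun u hu => ht u (Ioo_subset_Icc_self hu)) (by norm_num)
    (by
      rw [hw4, div_eq_one_iff_eq (by linarith)]
      ring)
    (fun u hu => (hderiv u hu).continuousAt.continuousWithinAt)
    (fun u hu htu => (hderiv u (Ioo_subset_Icc_self hu)).congr_deriv ?_)
  · convert! h using 1
    norm_num
  · have h4 : 1 - 3 * u ^ 4 ≠ 0 := by linarith [hlt u hu]
    have h1u : 1 - u ≠ 0 := by linarith [hu.2]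
    have h1t : 1 - 2 * u / (1 + u ^ 4)
        = (1 - u) * (1 - u - u ^ 2 - u ^ 3) / (1 + u ^ 4) := by
      field_simp
      ring
    have hc : 1 - u - u ^ 2 - u ^ 3 ≠ 0 := by
      intro hc
      rw [hc] at h1t
      simp only [mul_zero, zero_div] at h1t
      linarith
    rw [h1t, sumP, show 4 - 3 * (1 + u ^ 4) = 1 - 3 * u ^ 4 by ring]
    have hY : 1 + u ^ 4 ≠ 0 := by positivity
    generalize hC : 1 - u - u ^ 2 - u ^ 3 = C at hc ⊢
    generalize hD : 1 - 3 * u ^ 4 = D at h4 ⊢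
    generalize hE : 1 - u = E at h1u ⊢
    field_simp
    rw [← hC, ← hD, ← hE]
    ring

end Primitives

/-! ### Correction terms and elimination of `w`. -/

/-- The `- 1` in the factor of `β` removes the index `k = 0`, where the other terms vanish because
`H 0 = 0` and `γ / 0 = 0`. -/
theorem hasSum_pnat_choose_mul_add {w : ℝ} (hw : w ^ 3 + w ^ 2 + w = 1) (h1 : 543 / 1000 < w)
    (h2 : w < 544 / 1000) {m : ℕ} {S : ℝ}
    (hS : HasSum (fun k : ℕ => ((4 * k).choose k : ℝ) / 16 ^ k * (P k * H (m * k))) S) (α β γ : ℝ) :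
    HasSum (fun k : ℕ+ => ((4 * (k : ℕ)).choose k : ℝ) / (16 : ℝ) ^ (k : ℕ) *
        (P k * H (m * k) + α * ((k : ℕ) : ℝ) + β + γ / ((k : ℕ) : ℝ)))
      (S + α * (4 * (2 * w - 1) * (2 * w) * ((19 + 15 * w + 9 * w ^ 2) / 22) ^ 3)
        + β * (2 * w * ((19 + 15 * w + 9 * w ^ 2) / 22) - 1)
        + γ * (4 * (Real.log 2 + Real.log w))) := by
  have hroot := two_mul_root_mem h1 h2
  have hx := subst_root hw h1
  have hinv := inv_four_sub_root hw h2
  have hA0 := hasSum_choose_subst hroot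
  have hA1 := hasSum_mul_choose_subst hroot
  have hAlog := hasSum_choose_div_subst (by linarith : 1 < 2 * w) (by linarith)
  rw [hx] at hA0 hA1 hAlog
  rw [one_div] at hinv
  rw [div_eq_mul_inv (2 * w), hinv] at hA0
  rw [div_eq_mul_inv _ (_ ^ 3), ← inv_pow, hinv] at hA1
  rw [Real.log_mul two_ne_zero (by linarith)] at hAlog
  refine (hasSum_pnat_iff (f := fun k : ℕ => ((4 * k).choose k : ℝ) / (16 : ℝ) ^ k *
    (P k * H (m * k) + α * (k : ℝ) + β + γ / (k : ℝ)))).mpr ?_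
  convert! ((hS.add (hA1.mul_left α)).add (hA0.mul_left β)).add (hAlog.mul_left γ) using 1
  · ext k
    rw [div_pow, one_pow]
    ring
  · simp [H]
    ring

theorem theorem1 :
    HasSum (fun k : ℕ+ => ((4 * (k : ℕ)).choose k : ℝ) / (16 : ℝ) ^ (k : ℕ) *
        (P k * H k - 54 * ((k : ℕ) : ℝ) + 108 - 10 / (3 * ((k : ℕ) : ℝ))))
      (-(20 / 3) * Real.log 2) ∧
    HasSum (fun k : ℕ+ => ((4 * (k : ℕ)).choose k : ℝ) / (16 : ℝ) ^ (k : ℕ) *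
        (P k * H (2 * k) + 287 * ((k : ℕ) : ℝ) - 115 - 25 / (6 * ((k : ℕ) : ℝ))))
      (214 - 40 / 3 * Real.log 2) ∧
    HasSum (fun k : ℕ+ => ((4 * (k : ℕ)).choose k : ℝ) / (16 : ℝ) ^ (k : ℕ) *
        (P k * H (3 * k) - 296 * ((k : ℕ) : ℝ) + 178 - 25 / (3 * ((k : ℕ) : ℝ))))
      (-196 - 80 / 3 * Real.log 2) ∧
    HasSum (fun k : ℕ+ => ((4 * (k : ℕ)).choose k : ℝ) / (16 : ℝ) ^ (k : ℕ) *
        (P k * H (4 * k) - (449 * ((k : ℕ) : ℝ) - 275) / 2 - 85 / (12 * ((k : ℕ) : ℝ))))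
      (-151 - 80 / 3 * Real.log 2) := by
  obtain ⟨w, hw, h1, h2⟩ := exists_tribonacci_root
  have hw0 : w ≠ 0 := by linarith
  have hw1 : 1 - w ≠ 0 := by linarith
  have hinv := inv_four_sub_root hw h2
  have hlog2w : Real.log (2 * w) = Real.log 2 + Real.log w := Real.log_mul two_ne_zero hw0
  have hlog2 : Real.log (2 - 2 * w) = Real.log 2 + Real.log (1 - w) := by
    rw [← Real.log_mul two_ne_zero hw1, mul_sub, mul_one]
  -- Multiplicative relations in `ℚ(w)` express the remaining logarithms through `log 2` and `log
  -- w`.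
  have hlog1 : 3 * Real.log (1 - w) = Real.log 2 + 5 * Real.log w := by
    have h := congrArg Real.log (show (1 - w) ^ 3 = 2 * w ^ 5 by grind)
    rw [Real.log_mul two_ne_zero (pow_ne_zero 5 hw0), Real.log_pow, Real.log_pow] at h
    exact_mod_cast h
  have hlogsq : 3 * Real.log (1 - w ^ 2) = 2 * Real.log 2 + 4 * Real.log w := by
    have h := congrArg Real.log (show (1 - w ^ 2) ^ 3 = 2 ^ 2 * w ^ 4 by grind)
    rw [Real.log_mul (by norm_num) (pow_ne_zero 4 hw0), Real.log_pow, Real.log_pow,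
      Real.log_pow] at h
    exact_mod_cast h
  have hw4 : w ^ 4 = 2 * w - 1 := by linear_combination (w - 1) * hw
  have hw4' : (w ^ 2) ^ 2 = 2 * w - 1 := by rw [← hw4]; ring
  have hden : (1 - 3 * (2 * w - 1))⁻¹ = (19 + 15 * w + 9 * w ^ 2) / 22 := by
    rw [← hinv]
    ring
  -- At `u = 2w` one has `16 - 4u ^ 3 = (16 - u ^ 3) (4 - 3y)` with `16 - u ^ 3 = 8 / w`.
  have hden3 : (16 - 4 * (2 * w) ^ 3)⁻¹ = w * ((19 + 15 * w + 9 * w ^ 2) / 22) / 8 := by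
    refine inv_eq_of_mul_eq_one_right ?_
    grind
  rw [one_div] at hinv
  refine ⟨?_, ?_, ?_, ?_⟩
  · convert! hasSum_pnat_choose_mul_add hw h1 h2 (hasSum_P_mul_harmonic_one hw h1 h2)
      (-54) 108 (-(10 / 3)) using 1
    · ext k
      rw [one_mul]
      field_simp
      ring
    · rw [hlog2w, hlog2, div_eq_mul_inv _ (_ ^ 3), ← inv_pow, hinv]
      grind
  · convert! hasSum_pnat_choose_mul_add hw h1 h2 (hasSum_P_mul_harmonic_two hw h1 h2)
      287 (-115) (-(25 / 6)) using 1
    · ext k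
      field_simp
      ring
    · rw [hw4', show 1 + (2 * w - 1) = 2 * w by ring, hlog2w, div_eq_mul_inv _ (_ ^ 3),
        ← inv_pow, hden]
      grind
  · convert! hasSum_pnat_choose_mul_add hw h1 h2 (hasSum_P_mul_harmonic_three hw h1 h2)
      (-296) 178 (-(25 / 3)) using 1
    · ext k
      field_simp
      ring
    · rw [hlog2, div_eq_mul_inv _ (_ ^ 3), ← inv_pow, hden3]
      grind
  · convert! hasSum_pnat_choose_mul_add hw h1 h2 (hasSum_P_mul_harmonic_four hw h1 h2)
      (-(449 / 2)) (275 / 2) (-(85 / 12)) using 1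
    · ext k
      field_simp
      ring
    · rw [hw4, show 1 + (2 * w - 1) = 2 * w by ring, hlog2w, div_eq_mul_inv _ (_ ^ 3),
        ← inv_pow, hden]
      grind
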